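/- \textbf{Theorem (Butcher 1963).} Rooted trees are defined recursively as finite unordered lists $\beta=[\beta_1,\dots,\beta_n]$ ($n\ge 0$) of rooted trees; the single root is the empty list. Put $$\#\beta = 1+\#\beta_1+\dots+\#\beta_n,\qquad \beta! = (\#\beta)\,\beta_1!\cdots\beta_n!,$$ and, for a real $s\times s$ matrix $\mathcal A=(a_{ij})$, define $\mathcal A^{(\beta)}\in\mathbb R^s$ by $$\mathcal A^{(\beta)}_i=\bigl(\mathcal A\,\mathcal A^{(\beta_1)}\bigr)_i\cdots\bigl(\mathcal A\,\mathcal A^{(\beta_n)}\bigr)_i,\qquad i=1,\dots,s,$$ an empty sum being $0$ and an empty product $1$. Let $(b,\mathcal A)$, $b\in\mathbb R^s$, be a (possibly implicit) Runge--Kutta method and $p\in\mathbb N$, and suppose that $$b^T\mathcal A^{(\beta)}=\frac1{\beta!}\qquad\text{for every rooted tree }\beta\text{ with }\#\beta\le p.$$ Then the method has order $p$ for every autonomous system $x'=f(x)$ with $f\in C^p(\Omega,\mathbb R^d)$, $\Omega\subset\mathbb R^d$ open: for each $x\in\Omega$, $$\Phi^\tau x-\Psi^\tau x=O(\tau^{p+1})\qquad(\tau\to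 0).$$ Here $\tau\mapsto\Phi^\tau x$ is any solution in $\Omega$ of $x'=f(x)$ near $\tau=0$ with $\Phi^0x=x$, and $\Psi^\tau x=x+\tau\sum_{i=1}^s b_ik_i$ for $\tau$ near $0$, where the stages $k_i=k_i(\tau)$ are any solutions, bounded as $\tau\to0$, of $$k_i=f\Bigl(x+\tau\sum_{j=1}^s a_{ij}k_j\Bigr),\qquad i=1,\dots,s,$$ with all arguments of $f$ in $\Omega$. Moreover, if $p\ge1$, such a $\Phi^\tau x$ and such a $\Psi^\tau x$ exist for all $x\in\Omega$ and all $\tau$ in a neighbourhood of $0$ depending on $x$. -/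

import Mathlib

open Filter Topology Asymptotics
open scoped Matrix

/-- Ordered (plane) rooted trees: a tree is the tuple `(β₁, …, βₙ)` of its root's subtrees,
the single root being the empty tuple. -/
inductive PlaneTree : Type
  | node (n : ℕ) (c : Fin n → PlaneTree) : PlaneTree

namespace PlaneTree

/-- Two plane trees are the same unordered tree: the root's subtrees agree, recursively,
after a permutation. -/
inductive Equivalent : PlaneTree → PlaneTree → Prop
  | node {n : ℕ} {c c' : Fin n → PlaneTree} (σ : Equiv.Perm (Fin n))
      (h : ∀ i, Equivalent (c (σ i)) (c' i)) : Equivalent (node n c) (node n c')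

theorem Equivalent.refl (t : PlaneTree) : Equivalent t t := by
  induction t with
  | node n c ih => exact .node 1 ih

theorem Equivalent.symm {t t' : PlaneTree} (h : Equivalent t t') : Equivalent t' t := by
  induction h with
  | node σ _ ih =>
    refine .node σ⁻¹ fun i => ?_
    simpa using ih (σ⁻¹ i)

theorem Equivalent.trans {t t' t'' : PlaneTree} (h : Equivalent t t')
    (h' : Equivalent t' t'') : Equivalent t t'' := by
  induction h generalizing t'' with
  | node σ _ ih =>
    cases h' with
    | node τ h' => exact .node (σ * τ) fun i => ih (τ i) (h' i)

instance setoid : Setoid PlaneTree where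
  r := Equivalent
  iseqv := ⟨Equivalent.refl, Equivalent.symm, Equivalent.trans⟩

/-- The number of nodes, `#β = 1 + #β₁ + ⋯ + #βₙ`. -/
def order : PlaneTree → ℕ
  | node _ c => 1 + ∑ i, order (c i)

/-- The tree factorial, `β! = #β · β₁! ⋯ βₙ!`. -/
def factorial : PlaneTree → ℕ
  | node n c => order (node n c) * ∏ i, factorial (c i)

/-- The vector `A^(β)` with entries `A^(β)_i = (A · A^(β₁))_i ⋯ (A · A^(βₙ))_i`. -/
def stageVec {s : ℕ} (A : Matrix (Fin s) (Fin s) ℝ) : PlaneTree → Fin s → ℝ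
  | node _ c => fun i => ∏ j, (A *ᵥ stageVec A (c j)) i

theorem Equivalent.order_eq {t t' : PlaneTree} (h : Equivalent t t') : order t = order t' := by
  induction h with
  | @node n c c' σ _ ih =>
    simp only [order, ← ih]
    rw [Equiv.sum_comp σ fun i => order (c i)]

theorem Equivalent.factorial_eq {t t' : PlaneTree} (h : Equivalent t t') :
    factorial t = factorial t' := by
  induction h with
  | @node n c c' σ h ih =>
    rw [factorial, factorial, (Equivalent.node σ h).order_eq]
    simp only [← ih]
    rw [Equiv.prod_comp σ fun i => factorial (c i)]

theorem Equivalent.stageVec_eq {s : ℕ} (A : Matrix (Fin s) (Fin s) ℝ) {t t' : PlaneTree}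
    (h : Equivalent t t') : stageVec A t = stageVec A t' := by
  induction h with
  | @node n c c' σ _ ih =>
    funext i
    simp only [stageVec, ← ih]
    rw [Equiv.prod_comp σ fun j => (A *ᵥ stageVec A (c j)) i]

end PlaneTree

/-- Rooted trees `β = [β₁, …, βₙ]`, as unordered lists of subtrees. -/
def ButcherTree : Type := Quotient PlaneTree.setoid

namespace ButcherTree

/-- The order `#β`, i.e. the number of nodes. -/
def order (β : ButcherTree) : ℕ :=
  Quotient.lift PlaneTree.order (fun _ _ h => PlaneTree.Equivalent.order_eq h) β

/-- The tree factorial `β!`. -/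
def factorial (β : ButcherTree) : ℕ :=
  Quotient.lift PlaneTree.factorial (fun _ _ h => PlaneTree.Equivalent.factorial_eq h) β

/-- The vector `A^(β)`. -/
def stageVec {s : ℕ} (A : Matrix (Fin s) (Fin s) ℝ) (β : ButcherTree) : Fin s → ℝ :=
  Quotient.lift (PlaneTree.stageVec A) (fun _ _ h => PlaneTree.Equivalent.stageVec_eq A h) β

end ButcherTree

namespace RungeKutta

variable {d s : ℕ}

/-- Near `τ = 0`, `τ ↦ Φ τ` is a solution in `Ω` of `x' = f(x)` with `Φ 0 = x`. -/
def IsFlow (Ω : Set (EuclideanSpace ℝ (Fin d)))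
    (f : EuclideanSpace ℝ (Fin d) → EuclideanSpace ℝ (Fin d))
    (x : EuclideanSpace ℝ (Fin d)) (Φ : ℝ → EuclideanSpace ℝ (Fin d)) : Prop :=
  Φ 0 = x ∧ ∀ᶠ τ in 𝓝 (0 : ℝ), Φ τ ∈ Ω ∧ HasDerivAt Φ (f (Φ τ)) τ

/-- The vectors `k₁, …, kₛ` solve the stage equations `kᵢ = f(x + τ ∑ⱼ aᵢⱼ kⱼ)`, where all
arguments of `f` lie in its domain `Ω`. -/
def IsStages (A : Matrix (Fin s) (Fin s) ℝ) (Ω : Set (EuclideanSpace ℝ (Fin d)))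
    (f : EuclideanSpace ℝ (Fin d) → EuclideanSpace ℝ (Fin d))
    (x : EuclideanSpace ℝ (Fin d)) (τ : ℝ) (k : Fin s → EuclideanSpace ℝ (Fin d)) : Prop :=
  ∀ i, x + τ • ∑ j, A i j • k j ∈ Ω ∧ k i = f (x + τ • ∑ j, A i j • k j)

/-- Near `τ = 0`, `Ψ τ = x + τ ∑ᵢ bᵢ kᵢ` with stages `kᵢ = kᵢ(τ)`. The stages of an implicit
method are determined by the stage equations only up to spurious solutions that are unbounded
as `τ → 0`; these are excluded. For an explicit method and continuous `f` the boundedness is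
automatic. -/
def IsDiscreteFlow (A : Matrix (Fin s) (Fin s) ℝ) (b : Fin s → ℝ)
    (Ω : Set (EuclideanSpace ℝ (Fin d)))
    (f : EuclideanSpace ℝ (Fin d) → EuclideanSpace ℝ (Fin d))
    (x : EuclideanSpace ℝ (Fin d)) (Ψ : ℝ → EuclideanSpace ℝ (Fin d)) : Prop :=
  ∃ (k : ℝ → Fin s → EuclideanSpace ℝ (Fin d)) (C : ℝ), ∀ᶠ τ in 𝓝 (0 : ℝ),
    IsStages A Ω f x τ (k τ) ∧ (∀ i, ‖k τ i‖ ≤ C) ∧ Ψ τ = x + τ • ∑ i, b i • k τ i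

/-- The method `(b, A)` has order `p` for the autonomous system `x' = f(x)` on `Ω`:
`Φ^τ x - Ψ^τ x = O(τ^(p+1))` as `τ → 0`, for every `x ∈ Ω`. -/
def HasOrder (A : Matrix (Fin s) (Fin s) ℝ) (b : Fin s → ℝ)
    (Ω : Set (EuclideanSpace ℝ (Fin d)))
    (f : EuclideanSpace ℝ (Fin d) → EuclideanSpace ℝ (Fin d)) (p : ℕ) : Prop :=
  ∀ x ∈ Ω, ∀ Φ Ψ : ℝ → EuclideanSpace ℝ (Fin d),
    IsFlow Ω f x Φ → IsDiscreteFlow A b Ω f x Ψ →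
      (fun τ => Φ τ - Ψ τ) =O[𝓝 (0 : ℝ)] fun τ => τ ^ (p + 1)

end RungeKutta

/-! Both flows have truncated B-series in the same elementary differentials, with coefficient 1/β!
for the exact flow and bᵀA^(β) for the discrete one. The order conditions cancel every term with #β
≤ p, and the other terms are O(τ^(p+1)). Summing over plane trees removes symmetry factors: with D n
= f⁽ⁿ⁾(x)/n!, multilinearity expands D n (P, …, P) into one term per ordered tuple of subtrees. The
engine is `PlaneTree.isBigO_comp_sub_sum`: a B-series for h up to O(τ^(m+1)) gives one for f(x + h)
up to the same error. Integration (exact flow) or multiplication by τ (stages) then gains a power,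
so induction on m reaches p. -/

/-! ### Asymptotic estimates -/

/-- A function whose derivative near `0` is `O(τ ^ n)` is constant up to `O(τ ^ (n + 1))`. -/
theorem isBigO_sub_pow_succ_of_hasDerivAt {E : Type*} [NormedAddCommGroup E] [NormedSpace ℝ E]
    {g g' : ℝ → E} {n : ℕ} (hg : ∀ᶠ τ in 𝓝 (0 : ℝ), HasDerivAt g (g' τ) τ)
    (hg' : g' =O[𝓝 0] fun τ : ℝ => τ ^ n) :
    (fun τ => g τ - g 0) =O[𝓝 0] fun τ : ℝ => τ ^ (n + 1) := by
  obtain ⟨C, hC, hbound⟩ := hg'.exists_nonneg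
  obtain ⟨ε, hε, hball⟩ := Metric.eventually_nhds_iff_ball.1 (hg.and hbound.bound)
  refine IsBigO.of_bound C ?_
  filter_upwards [Metric.ball_mem_nhds (0 : ℝ) hε] with τ hτ
  have hmem : ∀ t ∈ Metric.closedBall (0 : ℝ) |τ|, t ∈ Metric.ball (0 : ℝ) ε := by
    intro t ht
    simp only [mem_closedBall_zero_iff, mem_ball_zero_iff, Real.norm_eq_abs] at *
    exact ht.trans_lt hτ
  have key := (convex_closedBall (0 : ℝ) |τ|).norm_image_sub_le_of_norm_hasDerivWithin_le
    (f := g) (f' := g') (C := C * |τ| ^ n) (x := 0) (y := τ)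
    (fun t ht => (hball t (hmem t ht)).1.hasDerivWithinAt)
    (fun t ht => by
      refine (hball t (hmem t ht)).2.trans ?_
      rw [norm_pow, Real.norm_eq_abs]
      have : |t| ≤ |τ| := by simpa using ht
      gcongr)
    (by simp) (by simp)
  simpa [pow_succ, mul_assoc] using key

/-- Taylor expansion of a `C^(n+1)` function with remainder `O(‖h‖ ^ (n + 1))`. -/
theorem ContDiffAt.isBigO_sub_sum_iteratedFDeriv {E F : Type*} [NormedAddCommGroup E]
    [NormedSpace ℝ E] [NormedAddCommGroup F] [NormedSpace ℝ F] [CompleteSpace F] {n : ℕ}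
    {f : E → F} {x : E} (hf : ContDiffAt ℝ (n + 1) f x) :
    (fun h => f (x + h) - ∑ k ∈ Finset.range (n + 1),
      ((k.factorial : ℝ)⁻¹ • iteratedFDeriv ℝ k f x) fun _ => h) =O[𝓝 0] fun h => ‖h‖ ^ (n + 1) := by
  have hcont : ContinuousAt (iteratedFDeriv ℝ (n + 1) f) x :=
    ContDiffAt.continuousAt_iteratedFDeriv hf (by norm_cast)
  obtain ⟨M, hM⟩ : ∃ M : ℝ, ∀ᶠ y in 𝓝 x, ‖iteratedFDeriv ℝ (n + 1) f y‖ ≤ M :=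
    ⟨_, (hcont.norm.eventually_lt_const (lt_add_one _)).mono fun _ => le_of_lt⟩
  have hM0 : 0 ≤ M := (norm_nonneg _).trans hM.self_of_nhds
  obtain ⟨ε, hε, hball⟩ := Metric.eventually_nhds_iff_ball.1
    (hM.and (hf.eventually (by norm_cast; simp)))
  refine IsBigO.of_bound ((n.factorial : ℝ)⁻¹ * M) ?_
  filter_upwards [Metric.ball_mem_nhds (0 : E) hε] with h hh
  have hmem : ∀ t ∈ Set.Icc (0 : ℝ) 1, x + t • h ∈ Metric.ball x ε := by
    intro t ht
    rw [mem_ball_zero_iff] at hh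
    rw [mem_ball_iff_norm, add_sub_cancel_left, norm_smul, Real.norm_of_nonneg ht.1]
    exact (mul_le_of_le_one_left (norm_nonneg _) ht.2).trans_lt hh
  rw [map_add_eq_sum_add_integral_iteratedFDeriv fun t ht => (hball _ (hmem t ht)).2]
  simp only [smul_apply, add_sub_cancel_left]
  rw [norm_smul, norm_inv, Real.norm_of_nonneg (Nat.cast_nonneg _), mul_assoc, norm_pow, norm_norm]
  gcongr
  have hint := intervalIntegral.norm_integral_le_of_norm_le_const (a := 0) (b := 1)
    (f := fun t : ℝ => (1 - t) ^ n • iteratedFDeriv ℝ (n + 1) f (x + t • h) fun _ => h)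
    (C := M * ‖h‖ ^ (n + 1)) fun t ht => by
      rw [Set.uIoc_of_le zero_le_one] at ht
      have hpow : ‖(1 - t) ^ n‖ ≤ 1 := by
        rw [norm_pow, Real.norm_of_nonneg (by linarith [ht.2])]
        exact pow_le_one₀ (by linarith [ht.2]) (by linarith [ht.1])
      rw [norm_smul]
      refine (mul_le_of_le_one_left (norm_nonneg _) hpow).trans ?_
      refine ((iteratedFDeriv ℝ (n + 1) f (x + t • h)).le_opNorm _).trans ?_
      simp only [Finset.prod_const, Finset.card_univ, Fintype.card_fin]
      gcongr
      exact (hball _ (hmem t ⟨ht.1.le, ht.2⟩)).1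
  simpa using hint

theorem isBigO_pow_smul_const {E : Type*} [NormedAddCommGroup E] [NormedSpace ℝ E] {i j : ℕ}
    (hij : i ≤ j) (v : E) : (fun τ : ℝ => τ ^ j • v) =O[𝓝 0] fun τ : ℝ => τ ^ i := by
  have hpow : (fun τ : ℝ => τ ^ j) =O[𝓝 0] fun τ : ℝ => τ ^ i := by
    obtain rfl | hij := hij.eq_or_lt
    exacts [isBigO_refl _ _, (isLittleO_pow_pow hij).isBigO]
  have hv : (fun _ : ℝ => v) =O[𝓝 0] fun _ : ℝ => (1 : ℝ) :=
    isBigO_const_const v one_ne_zero _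
  simpa using hpow.smul hv

theorem isBigO_smul_sum_pow_succ {E ι : Type*} [NormedAddCommGroup E] [NormedSpace ℝ E]
    [Fintype ι] {g : ι → ℝ → E} {n : ℕ} (c : ι → ℝ)
    (hg : ∀ j, g j =O[𝓝 0] fun τ : ℝ => τ ^ n) :
    (fun τ : ℝ => τ • ∑ j, c j • g j τ) =O[𝓝 0] fun τ : ℝ => τ ^ (n + 1) := by
  have hsum : (fun τ : ℝ => ∑ j, c j • g j τ) =O[𝓝 0] fun τ : ℝ => τ ^ n :=
    IsBigO.fun_sum fun j _ => (hg j).const_smul_left (c j)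
  simpa [pow_succ'] using (isBigO_refl (fun τ : ℝ => τ) (𝓝 0)).smul hsum

/-! ### Truncated B-series and composition with f -/

namespace PlaneTree

theorem order_pos (t : PlaneTree) : 0 < order t := by
  cases t with
  | node n c => simp [order]

theorem factorial_pos (t : PlaneTree) : 0 < factorial t := by
  induction t with
  | node n c ih => exact Nat.mul_pos (order_pos _) (Finset.prod_pos fun i _ => ih i)

/-- The plane trees of height less than `m` all of whose nodes have fewer than `p` children. -/
def bounded (p : ℕ) : ℕ → Finset PlaneTree
  | 0 => ∅
  | m + 1 => ((Finset.range p).sigma fun n => Fintype.piFinset fun _ : Fin n => bounded p m).map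
      ⟨fun c => node c.1 c.2, fun c c' h => by
        obtain ⟨n, c⟩ := c
        obtain ⟨n', c'⟩ := c'
        dsimp only at h
        injection h with hn hc
        subst hn
        rw [eq_of_heq hc]⟩

theorem sum_bounded_succ {E : Type*} [AddCommMonoid E] (p m : ℕ) (g : PlaneTree → E) :
    ∑ t ∈ bounded p (m + 1), g t =
      ∑ n ∈ Finset.range p, ∑ c ∈ Fintype.piFinset fun _ : Fin n => bounded p m, g (node n c) := by
  rw [bounded, Finset.sum_map, Finset.sum_sigma]
  rfl

/-- The elementary differentials built from the multilinear maps `D n`. -/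
def elementaryDifferential {E : Type*} [NormedAddCommGroup E] [NormedSpace ℝ E]
    (D : ∀ n, E[×n]→L[ℝ] E) : PlaneTree → E
  | node n c => D n fun i => elementaryDifferential D (c i)

/-- If `h` is given by a truncated B-series with coefficients `a`, then so is `f (x + h)`, and its
coefficient at a tree is the product of those at the subtrees of the root. -/
theorem isBigO_comp_sub_sum {E : Type*} [NormedAddCommGroup E] [NormedSpace ℝ E]
    {f : E → E} {x : E} {p m : ℕ} {D : ∀ n, E[×n]→L[ℝ] E}
    (hf : (fun h => f (x + h) - ∑ n ∈ Finset.range p, D n fun _ => h) =O[𝓝 0] fun h => ‖h‖ ^ p)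
    (hm : m < p) {a a' : PlaneTree → ℝ} (ha : ∀ n c, a' (node n c) = ∏ i, a (c i)) {h : ℝ → E}
    (hh : (fun τ => h τ - ∑ t ∈ bounded p m, (τ ^ order t * a t) • elementaryDifferential D t)
      =O[𝓝 0] fun τ : ℝ => τ ^ (m + 1)) :
    (fun τ => f (x + h τ) -
        ∑ t ∈ bounded p (m + 1), (τ ^ (order t - 1) * a' t) • elementaryDifferential D t)
      =O[𝓝 0] fun τ : ℝ => τ ^ (m + 1) := by
  set P : ℝ → E := fun τ => ∑ t ∈ bounded p m, (τ ^ order t * a t) • elementaryDifferential D t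
  set Q : E → E := fun h => ∑ n ∈ Finset.range p, D n fun _ => h
  have hP : P =O[𝓝 0] fun τ : ℝ => τ := by
    refine IsBigO.fun_sum fun t _ => ?_
    simp only [mul_smul]
    simpa using isBigO_pow_smul_const (order_pos t) (a t • elementaryDifferential D t)
  have hO : h =O[𝓝 0] fun τ : ℝ => τ := by
    have hpow : (fun τ : ℝ => τ ^ (m + 1)) =O[𝓝 0] fun τ : ℝ => τ := by
      simpa using isBigO_pow_smul_const (Nat.le_add_left 1 m) (1 : ℝ)
    exact ((hh.trans hpow).add hP).congr_left fun τ => sub_add_cancel _ _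
  have hid : Tendsto (fun τ : ℝ => τ) (𝓝 0) (𝓝 0) := tendsto_id
  have hP0 := hP.trans_tendsto hid
  have hh0 := hO.trans_tendsto hid
  -- Q is polynomial, hence Lipschitz near 0, so replacing h by P costs no more than the error h -
  -- P.
  have hQ : ContDiff ℝ 1 Q := by
    refine ContDiff.sum fun n _ => (D n).contDiff.comp ?_
    fun_prop
  -- The Taylor remainder is O(τ^p), and m + 1 ≤ p.
  have h1 : (fun τ => f (x + h τ) - Q (h τ)) =O[𝓝 0] fun τ : ℝ => τ ^ (m + 1) :=
    (hf.comp_tendsto hh0).trans <| (hO.norm_left.pow p).trans <| by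
      simpa using isBigO_pow_smul_const hm (1 : ℝ)
  have h2 : (fun τ => Q (h τ) - Q (P τ)) =O[𝓝 0] fun τ : ℝ => τ ^ (m + 1) :=
    ((hQ.contDiffAt.hasStrictFDerivAt one_ne_zero).isBigO_sub.comp_tendsto
      (hh0.prodMk_nhds hP0)).trans hh
  -- The powers of τ at the subtrees multiply to τ^(#t - 1), since only the root of t is missing.
  have h3 : ∀ τ, Q (P τ) =
      ∑ t ∈ bounded p (m + 1), (τ ^ (order t - 1) * a' t) • elementaryDifferential D t := by
    intro τ
    rw [sum_bounded_succ]
    refine Finset.sum_congr rfl fun n _ => ?_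
    rw [ContinuousMultilinearMap.map_sum_finset]
    refine Finset.sum_congr rfl fun c _ => ?_
    rw [ContinuousMultilinearMap.map_smul_univ, Finset.prod_mul_distrib, ha,
      Finset.prod_pow_eq_pow_sum]
    simp [order, elementaryDifferential]
  simpa only [h3, sub_add_sub_cancel] using h1.add h2

end PlaneTree

/-! ### Expansions of the exact and discrete flows -/

namespace RungeKutta

open PlaneTree

variable {d s : ℕ} {Ω : Set (EuclideanSpace ℝ (Fin d))}
  {f : EuclideanSpace ℝ (Fin d) → EuclideanSpace ℝ (Fin d)} {x : EuclideanSpace ℝ (Fin d)}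

/-- The B-series of the exact flow. -/
theorem IsFlow.isBigO_sub_sum {Φ : ℝ → EuclideanSpace ℝ (Fin d)} (hΦ : IsFlow Ω f x Φ) {p : ℕ}
    {D : ∀ n, EuclideanSpace ℝ (Fin d) [×n]→L[ℝ] EuclideanSpace ℝ (Fin d)}
    (hf : (fun h => f (x + h) - ∑ n ∈ Finset.range p, D n fun _ => h) =O[𝓝 0] fun h => ‖h‖ ^ p)
    {m : ℕ} (hm : m ≤ p) :
    (fun τ => (Φ τ - x) -
        ∑ t ∈ bounded p m, (τ ^ order t * (1 / (factorial t : ℝ))) • elementaryDifferential D t)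
      =O[𝓝 0] fun τ : ℝ => τ ^ (m + 1) := by
  obtain ⟨hΦ0, hΦ⟩ := hΦ
  induction m with
  | zero =>
    have := hΦ.self_of_nhds.2.isBigO_sub
    simpa [bounded, hΦ0] using this
  | succ m ih =>
    -- The recursion for t! makes #t/t! the product of the 1/βᵢ! over the root's subtrees; it is
    -- also the coefficient obtained by differentiating τ^#t/t!.
    have key := isBigO_comp_sub_sum hf hm (a := fun t => 1 / (factorial t : ℝ))
      (a' := fun t => order t / (factorial t : ℝ)) (fun n c => ?_) (ih (by omega))
    · simp only [add_sub_cancel] at key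
      have := isBigO_sub_pow_succ_of_hasDerivAt (g := fun τ => (Φ τ - x) -
        ∑ t ∈ bounded p (m + 1),
          (τ ^ order t * (1 / (factorial t : ℝ))) • elementaryDifferential D t) ?_ key
      · simpa [hΦ0, (order_pos _).ne'] using this
      · filter_upwards [hΦ] with τ hτ
        refine (hτ.2.sub_const x).sub (HasDerivAt.fun_sum fun t _ => ?_)
        convert ((hasDerivAt_pow (order t) τ).mul_const (1 / (factorial t : ℝ))).smul_const
          (elementaryDifferential D t) using 2
        ring
    · have : (order (node n c) : ℝ) ≠ 0 := by exact_mod_cast (order_pos _).ne'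
      simp only [factorial, Nat.cast_mul, Nat.cast_prod, one_div, Finset.prod_inv_distrib]
      field_simp

/-- The B-series of the stages. -/
theorem isBigO_stages_sub_sum {A : Matrix (Fin s) (Fin s) ℝ}
    {k : ℝ → Fin s → EuclideanSpace ℝ (Fin d)} {C : ℝ}
    (hk : ∀ᶠ τ in 𝓝 (0 : ℝ), IsStages A Ω f x τ (k τ) ∧ ∀ i, ‖k τ i‖ ≤ C) {p : ℕ}
    {D : ∀ n, EuclideanSpace ℝ (Fin d) [×n]→L[ℝ] EuclideanSpace ℝ (Fin d)}
    (hf : (fun h => f (x + h) - ∑ n ∈ Finset.range p, D n fun _ => h) =O[𝓝 0] fun h => ‖h‖ ^ p)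
    {m : ℕ} (hm : m ≤ p) (i : Fin s) :
    (fun τ => k τ i -
        ∑ t ∈ bounded p m, (τ ^ (order t - 1) * stageVec A t i) • elementaryDifferential D t)
      =O[𝓝 0] fun τ : ℝ => τ ^ m := by
  induction m generalizing i with
  | zero =>
    -- The induction starts from boundedness of the stages, which is what rules out spurious
    -- solutions.
    refine IsBigO.of_bound C ?_
    filter_upwards [hk] with τ hτ
    simpa [bounded] using hτ.2 i
  | succ m ih =>
    have key := isBigO_comp_sub_sum hf hm (a := fun t => (A *ᵥ stageVec A t) i)
      (a' := fun t => stageVec A t i) (fun n c => by rw [stageVec])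
      (h := fun τ => τ • ∑ j, A i j • k τ j) ?_
    · refine key.congr' ?_ EventuallyEq.rfl
      filter_upwards [hk] with τ hτ
      rw [← (hτ.1 i).2]
    · have hsum : (fun τ : ℝ => τ • ∑ j, A i j • (k τ j -
          ∑ t ∈ bounded p m, (τ ^ (order t - 1) * stageVec A t j) • elementaryDifferential D t))
          =O[𝓝 0] fun τ : ℝ => τ ^ (m + 1) := by
        exact isBigO_smul_sum_pow_succ (A i) fun j => ih (by omega) j
      refine hsum.congr_left fun τ => ?_
      simp only [smul_sub, Finset.sum_sub_distrib, Finset.smul_sum, smul_smul]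
      congr 1
      rw [Finset.sum_comm]
      refine Finset.sum_congr rfl fun t _ => ?_
      rw [← Finset.sum_smul, Matrix.mulVec, dotProduct, Finset.mul_sum]
      congr 1
      refine Finset.sum_congr rfl fun j _ => ?_
      -- As #t ≥ 1, the truncated subtraction is harmless: τ · τ^(#t - 1) = τ^#t.
      obtain ⟨q, hq⟩ := Nat.exists_eq_succ_of_ne_zero (order_pos t).ne'
      simp only [hq, Nat.succ_sub_one, pow_succ]
      ring

/-- The B-series of the discrete flow. -/
theorem IsDiscreteFlow.isBigO_sub_sum {A : Matrix (Fin s) (Fin s) ℝ} {b : Fin s → ℝ}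
    {Ψ : ℝ → EuclideanSpace ℝ (Fin d)} (hΨ : IsDiscreteFlow A b Ω f x Ψ) {p : ℕ}
    {D : ∀ n, EuclideanSpace ℝ (Fin d) [×n]→L[ℝ] EuclideanSpace ℝ (Fin d)}
    (hf : (fun h => f (x + h) - ∑ n ∈ Finset.range p, D n fun _ => h) =O[𝓝 0] fun h => ‖h‖ ^ p) :
    (fun τ => (Ψ τ - x) -
        ∑ t ∈ bounded p p, (τ ^ order t * (b ⬝ᵥ stageVec A t)) • elementaryDifferential D t)
      =O[𝓝 0] fun τ : ℝ => τ ^ (p + 1) := by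
  obtain ⟨k, C, hk⟩ := hΨ
  have hsum : (fun τ : ℝ => τ • ∑ j, b j • (k τ j -
      ∑ t ∈ bounded p p, (τ ^ (order t - 1) * stageVec A t j) • elementaryDifferential D t))
      =O[𝓝 0] fun τ : ℝ => τ ^ (p + 1) := by
    exact isBigO_smul_sum_pow_succ b
      (isBigO_stages_sub_sum (hk.mono fun _ h => ⟨h.1, h.2.1⟩) hf le_rfl)
  refine hsum.congr' ?_ EventuallyEq.rfl
  filter_upwards [hk] with τ hτ
  rw [hτ.2.2, add_sub_cancel_left]
  simp only [smul_sub, Finset.sum_sub_distrib, Finset.smul_sum, smul_smul]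
  congr 1
  rw [Finset.sum_comm]
  refine Finset.sum_congr rfl fun t _ => ?_
  rw [← Finset.sum_smul, dotProduct, Finset.mul_sum]
  congr 1
  refine Finset.sum_congr rfl fun j _ => ?_
  obtain ⟨q, hq⟩ := Nat.exists_eq_succ_of_ne_zero (order_pos t).ne'
  simp only [hq, Nat.succ_sub_one, pow_succ]
  ring

/-- No regularity of f is needed: Φ is differentiable at 0 and the stages are bounded, so both flows
are x + O(τ). -/
theorem hasOrder_zero (A : Matrix (Fin s) (Fin s) ℝ) (b : Fin s → ℝ) : HasOrder A b Ω f 0 := by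
  rintro x - Φ Ψ hΦ hΨ
  obtain ⟨hΦ0, hΦ⟩ := hΦ
  obtain ⟨k, C, hk⟩ := hΨ
  have h1 : (fun τ => Φ τ - x) =O[𝓝 0] fun τ : ℝ => τ ^ (0 + 1) := by
    simpa [hΦ0] using hΦ.self_of_nhds.2.isBigO_sub
  have h2 : (fun τ : ℝ => τ • ∑ i, b i • k τ i) =O[𝓝 0] fun τ : ℝ => τ ^ (0 + 1) :=
    isBigO_smul_sum_pow_succ (g := fun i τ => k τ i) b fun i =>
      IsBigO.of_bound C (hk.mono fun τ hτ => by simpa using hτ.2.1 i)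
  refine (h1.sub h2).congr' ?_ EventuallyEq.rfl
  filter_upwards [hk] with τ hτ
  rw [hτ.2.2]
  abel

theorem hasOrder_succ {A : Matrix (Fin s) (Fin s) ℝ} {b : Fin s → ℝ} {n : ℕ}
    (hcond : ∀ t : PlaneTree, order t ≤ n + 1 → b ⬝ᵥ stageVec A t = 1 / (factorial t : ℝ))
    (hΩ : IsOpen Ω) (hf : ContDiffOn ℝ (n + 1) f Ω) : HasOrder A b Ω f (n + 1) := by
  intro x hx Φ Ψ hΦ hΨ
  have hT := (hf.contDiffAt (hΩ.mem_nhds hx)).isBigO_sub_sum_iteratedFDeriv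
  set D : ∀ k, EuclideanSpace ℝ (Fin d) [×k]→L[ℝ] EuclideanSpace ℝ (Fin d) :=
    fun k => (k.factorial : ℝ)⁻¹ • iteratedFDeriv ℝ k f x
  have hsum : (fun τ : ℝ => ∑ t ∈ bounded (n + 1) (n + 1),
      (τ ^ order t * (b ⬝ᵥ stageVec A t - 1 / (factorial t : ℝ))) • elementaryDifferential D t)
      =O[𝓝 0] fun τ : ℝ => τ ^ (n + 1 + 1) := by
    -- `bounded` also contains trees of order above n + 1; their terms are absorbed into the error.
    refine IsBigO.fun_sum fun t _ => ?_
    by_cases ht : order t ≤ n + 1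
    · simpa [hcond t ht] using isBigO_zero _ _
    · simp only [mul_smul]
      exact isBigO_pow_smul_const (not_le.1 ht) _
  refine (((hΦ.isBigO_sub_sum (D := D) hT le_rfl).sub
    (hΨ.isBigO_sub_sum (D := D) hT)).sub hsum).congr_left fun τ => ?_
  simp only [mul_sub, sub_smul, Finset.sum_sub_distrib]
  abel

/-! ### Existence of both flows -/

theorem exists_isFlow (hΩ : IsOpen Ω) (hf : ContDiffOn ℝ 1 f Ω) (hx : x ∈ Ω) :
    ∃ Φ, IsFlow Ω f x Φ := by
  obtain ⟨Φ, hΦ0, ε, hε, hΦ⟩ := (hf.contDiffAt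
    (hΩ.mem_nhds hx)).exists_forall_mem_closedBall_exists_eq_forall_mem_Ioo_hasDerivAt₀ 0
  refine ⟨Φ, hΦ0, ?_⟩
  have hcont : ContinuousAt Φ 0 := (hΦ 0 (by simpa using hε)).continuousAt
  filter_upwards [hcont.preimage_mem_nhds (hΩ.mem_nhds (hΦ0.symm ▸ hx)),
    Ioo_mem_nhds (sub_neg.2 hε) (lt_add_of_pos_right 0 hε)] with τ h1 h2
  exact ⟨h1, hΦ τ h2⟩

/-- The implicit function theorem applies to the stage equations G(τ, k) = 0 at τ = 0, where G(0, k)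
= k - k₀ has the identity as its derivative in k. The resulting branch tends to k₀, hence is bounded
and keeps the arguments of f in Ω. -/
theorem exists_isDiscreteFlow (A : Matrix (Fin s) (Fin s) ℝ) (b : Fin s → ℝ) (hΩ : IsOpen Ω)
    (hf : ContDiffOn ℝ 1 f Ω) (hx : x ∈ Ω) : ∃ Ψ, IsDiscreteFlow A b Ω f x Ψ := by
  have hfx : ContDiffAt ℝ 1 f x := hf.contDiffAt (hΩ.mem_nhds hx)
  let K := Fin s → EuclideanSpace ℝ (Fin d)
  let y : Fin s → ℝ × K → EuclideanSpace ℝ (Fin d) := fun i v => x + v.1 • ∑ j, A i j • v.2 j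
  have hy : ∀ i, ContDiff ℝ 1 (y i) := fun i => by fun_prop
  let k₀ : K := fun _ => f x
  have hy0 : ∀ i (k : K), y i (0, k) = x := fun i k => by simp [y]
  let G : ℝ × K → K := fun v => v.2 - fun i => f (y i v)
  have hG : ContDiffAt ℝ 1 G (0, k₀) := by
    refine contDiffAt_snd.sub (contDiffAt_pi.2 fun i => ?_)
    refine ContDiffAt.comp (0, k₀) ?_ (hy i).contDiffAt
    rwa [hy0]
  have hG0 : G (0, k₀) = 0 := by
    simp only [G, hy0]
    exact sub_self k₀
  have hstrict := hG.hasStrictFDerivAt one_ne_zero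
  have hinr : fderiv ℝ G (0, k₀) ∘L .inr ℝ ℝ K = .id ℝ K := by
    have h1 : HasFDerivAt (fun k : K => G (0, k)) (fderiv ℝ G (0, k₀) ∘L .inr ℝ ℝ K) k₀ :=
      HasFDerivAt.comp k₀ hstrict.hasFDerivAt (hasFDerivAt_prodMk_right 0 k₀)
    refine h1.unique ?_
    have : (fun k : K => G (0, k)) = fun k => k - k₀ := by
      funext k
      simp only [G, hy0]
      rfl
    rw [this]
    exact (hasFDerivAt_id k₀).sub_const k₀
  have hinv : (fderiv ℝ G (0, k₀) ∘L .inr ℝ ℝ K).IsInvertible := by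
    rw [hinr]
    exact ⟨.refl ℝ K, rfl⟩
  let k := hstrict.implicitFunctionOfProdDomain hinv
  have hk : Tendsto k (𝓝 0) (𝓝 k₀) := hstrict.tendsto_implicitFunctionOfProdDomain hinv
  have hkG : ∀ᶠ τ in 𝓝 (0 : ℝ), G (τ, k τ) = G (0, k₀) :=
    hstrict.eventually_apply_implicitFunctionOfProdDomain hinv
  have hmem : ∀ᶠ τ in 𝓝 (0 : ℝ), ∀ i, y i (τ, k τ) ∈ Ω := by
    refine eventually_all.2 fun i => ?_
    have := ((hy i).continuous.tendsto (0, k₀)).comp (tendsto_id.prodMk_nhds hk)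
    rw [hy0] at this
    exact this.eventually (hΩ.mem_nhds hx)
  refine ⟨fun τ => x + τ • ∑ i, b i • k τ i, k, ‖k₀‖ + 1, ?_⟩
  filter_upwards [hkG, hmem, hk.norm.eventually_lt_const (lt_add_one _)] with τ h1 h2 h3
  refine ⟨fun i => ⟨h2 i, ?_⟩, fun i => (norm_le_pi_norm _ i).trans h3.le, rfl⟩
  exact congrFun (sub_eq_zero.1 (h1.trans hG0)) i

end RungeKutta

theorem mainTheorem1 {s : ℕ} (A : Matrix (Fin s) (Fin s) ℝ) (b : Fin s → ℝ) (p : ℕ)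
    (hcond : ∀ β : ButcherTree, β.order ≤ p → b ⬝ᵥ β.stageVec A = 1 / (β.factorial : ℝ))
    {d : ℕ} (Ω : Set (EuclideanSpace ℝ (Fin d))) (hΩ : IsOpen Ω)
    (f : EuclideanSpace ℝ (Fin d) → EuclideanSpace ℝ (Fin d)) (hf : ContDiffOn ℝ p f Ω) :
    RungeKutta.HasOrder A b Ω f p ∧
      (1 ≤ p → ∀ x ∈ Ω, (∃ Φ, RungeKutta.IsFlow Ω f x Φ) ∧
        ∃ Ψ, RungeKutta.IsDiscreteFlow A b Ω f x Ψ) := by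
  refine ⟨?_, fun hp x hx => ?_⟩
  · cases p with
    | zero => exact RungeKutta.hasOrder_zero A b
    | succ n =>
      -- The condition on an unordered tree is, by unfolding the quotient lifts, the condition on
      -- each of its plane representatives.
      exact RungeKutta.hasOrder_succ (fun t ht => hcond (Quotient.mk _ t) ht) hΩ
        (by exact_mod_cast hf)
  · have hf1 : ContDiffOn ℝ 1 f Ω := hf.of_le (by exact_mod_cast hp)
    exact ⟨RungeKutta.exists_isFlow hΩ hf1 hx, RungeKutta.exists_isDiscreteFlow A b hΩ hf1 hx⟩
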